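/- Let $K$ be an algebraically closed field of characteristic $0$, let $T\cong\mathbb G_m^r$ be a torus over $K$, and let $V$ be a finite-dimensional (algebraic) representation of $T$. A vector $v\in V$ is called stable if its orbit $Tv$ is Zariski closed and $v$ does not lie in the closure of any other orbit; $V$ is called stable if it contains a stable vector. Let $V^{\mathrm{sss}}\subseteq V$ be the set of vectors that are not stable, and let $\pi\colon V\to V/T=\operatorname{Spec}K[V]^T$ be the quotient map. Call $V$ cofree if $K[V]$ is a free $K[V]^T$-module. Call $V$ cnpure if every irreducible component $Z$ of $V^{\mathrm{sss}}$ has codimension one in $V$, its image $\pi(Z)$ has codimension one in $V/T$, and $\pi(Z)$ (with its reduced structure) is a principal divisor, i.e. the ideal of all $f\in K[V]^T$ that vanish on $Z$ is principal. Theorem. If $V$ is stable, then $V$ is cofree if and only if $V$ is cnpure. -/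

import Mathlib

open scoped Topology

namespace TorusRep

section Affine

variable (K : Type*) [Field K] (V : Type*) [AddCommGroup V] [Module K V]

/-- The coordinate ring `K[V]` of a vector space `V` over an infinite field `K`: the algebra of
polynomial functions on `V`, i.e. the `K`-algebra of functions generated by the linear forms. -/
def coordRing : Subalgebra K (V → K) :=
  Algebra.adjoin K (Set.range fun l : Module.Dual K V => (l : V → K))

variable {K V} in
/-- The common zero locus in `V` of a set of polynomial functions. -/
def zeroLocus (S : Set (coordRing K V)) : Set V :=
  {v | ∀ f ∈ S, f.1 v = 0}

/-- The Zariski topology on `V`: the closed sets are the zero loci of sets of polynomial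
functions. -/
@[reducible] def zariski : TopologicalSpace V :=
  TopologicalSpace.ofClosed (Set.range (zeroLocus (K := K) (V := V)))
    ⟨{1}, by
      ext v
      simp [zeroLocus]⟩
    (by
      intro A hA
      refine ⟨{f | ∃ S : Set (coordRing K V), zeroLocus S ∈ A ∧ f ∈ S}, ?_⟩
      ext v
      simp only [zeroLocus, Set.mem_ofPred_eq, Set.mem_sInter]
      constructor
      · intro h Z hZ
        obtain ⟨S, rfl⟩ := hA hZ
        exact fun f hf => h f ⟨S, hZ, hf⟩
      · rintro h f ⟨S, hS, hf⟩
        exact h _ hS f hf)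
    (by
      rintro _ ⟨S, rfl⟩ _ ⟨S', rfl⟩
      refine ⟨{h | ∃ f ∈ S, ∃ g ∈ S', h = f * g}, ?_⟩
      ext v
      simp only [zeroLocus, Set.mem_ofPred_eq, Set.mem_union]
      constructor
      · intro h
        by_contra! hc
        obtain ⟨⟨f, hf, hfv⟩, g, hg, hgv⟩ := hc
        exact (mul_ne_zero hfv hgv) (h _ ⟨f, hf, g, hg, rfl⟩)
      · rintro (h | h) _ ⟨f, hf, g, hg, rfl⟩
        · simp [h f hf]
        · simp [h g hg])

variable {V} in
/-- The irreducible components of a subset `Z` of `V` (in the Zariski topology): the maximal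
irreducible subsets of `Z`. -/
def components (Z : Set V) : Set (Set V) :=
  {Y | Maximal (fun Y' : Set V => @IsIrreducible V (zariski K V) Y' ∧ Y' ⊆ Z) Y}

variable {V} in
/-- The ideal of `K[V]` of all polynomial functions that vanish on `Z`. -/
def idealOf (Z : Set V) : Ideal (coordRing K V) where
  carrier := {f | ∀ v ∈ Z, f.1 v = 0}
  zero_mem' := fun _ _ => rfl
  add_mem' := fun {f g} hf hg v hv => by simp [hf v hv, hg v hv]
  smul_mem' := fun c f hf v hv => by simp [hf v hv]

end Affine

section Action

variable {K : Type*} [Field K] {V : Type*} [AddCommGroup V] [Module K V] {r : ℕ}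
  (ρ : Representation K (Fin r → Kˣ) V)

/-- A linear action of (the group of `K`-points of) the torus `T = 𝔾ₘ ^ r` on `V` is a
representation of the algebraic group `T` if all matrix coefficients are regular functions on `T`,
that is, Laurent polynomials in the coordinates `t 0, …, t (r - 1)`. -/
def IsAlgebraic : Prop :=
  ∀ (l : Module.Dual K V) (v : V), ∃ c : (Fin r → ℤ) →₀ K, ∀ t : Fin r → Kˣ,
    l (ρ t v) = c.sum fun m a => a * ((∏ i, t i ^ m i : Kˣ) : K)

/-- The orbit `T v`. -/
def orbit (v : V) : Set V := Set.range fun t : Fin r → Kˣ => ρ t v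

/-- `v` is stable: its orbit is Zariski closed and `v` is not in the Zariski closure of any other
orbit. -/
def IsStableVector (v : V) : Prop :=
  IsClosed[zariski K V] (orbit ρ v) ∧
    ∀ w : V, v ∈ closure[zariski K V] (orbit ρ w) → orbit ρ w = orbit ρ v

/-- A representation is stable if it contains a stable vector. -/
def IsStable : Prop := ∃ v : V, IsStableVector ρ v

/-- The strictly semistable locus: the complement of the set of stable vectors. -/
def strictlySemistable : Set V := {v | ¬ IsStableVector ρ v}

/-- The ring `K[V]^T` of invariant polynomial functions. -/
def invariantRing : Subalgebra K (coordRing K V) where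
  carrier := {f | ∀ (t : Fin r → Kˣ) (v : V), f.1 (ρ t v) = f.1 v}
  mul_mem' := fun {f g} hf hg t v => by simp [hf t v, hg t v]
  add_mem' := fun {f g} hf hg t v => by simp [hf t v, hg t v]
  algebraMap_mem' := fun _ _ _ => rfl

/-- `V` is cofree: `K[V]` is a free `K[V]^T`-module. -/
def IsCofree : Prop := Module.Free (invariantRing ρ) (coordRing K V)

/-- Evaluation of invariants at a vector. -/
def evalInvariant (v : V) : invariantRing ρ →+* K :=
  (Pi.evalRingHom (fun _ : V => K) v).comp
    ((coordRing K V).val.toRingHom.comp (invariantRing ρ).val.toRingHom)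

/-- The quotient map `π : V → V/T = Spec K[V]^T` on `K`-points: `v` is sent to the (maximal) ideal
of invariants vanishing at `v`. -/
def quotientMap (v : V) : PrimeSpectrum (invariantRing ρ) :=
  ⟨RingHom.ker (evalInvariant ρ v), RingHom.ker_isPrime _⟩

/-- The ideal in `K[V]^T` of the image `π(Z)` (a reduced closed subscheme of `V/T`, after taking
closure). -/
def imageIdeal (Z : Set V) : Ideal (invariantRing ρ) :=
  PrimeSpectrum.vanishingIdeal (quotientMap ρ '' Z)

/-- `V` is pure: every irreducible component of the strictly semistable locus has codimension one
in `V`. -/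
def IsPure : Prop :=
  ∀ Z ∈ components K (strictlySemistable ρ), (idealOf K Z).height = 1

/-- `V` is npure: it is pure, and every irreducible component of the strictly semistable locus maps
to a divisor, i.e. to a subvariety of codimension one, of `V/T`. -/
def IsNPure : Prop :=
  IsPure ρ ∧ ∀ Z ∈ components K (strictlySemistable ρ),
    Ideal.height (R := invariantRing ρ) (imageIdeal ρ Z) = 1

/-- `V` is cnpure: it is npure, and every irreducible component of the strictly semistable locus
maps to a principal divisor of `V/T`, i.e. one whose ideal in `K[V]^T` is generated by one
element. -/
def IsCNPure : Prop :=
  IsNPure ρ ∧ ∀ Z ∈ components K (strictlySemistable ρ), (imageIdeal ρ Z).IsPrincipal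

end Action

end TorusRep

/-!
# Cofree and cnpure representations of tori

Algebraic representations of a torus are diagonalizable (`exists_weightBasis`), and in coordinates
`x i` with respect to a basis of weight vectors everything is governed by the monoid `S` of
exponents of invariant monomials (`exponents`): the invariant polynomials are those all of whose
exponents are in `S`. For stable `V`, both conditions in the theorem are equivalent to `S` being
closed under coordinatewise minima, which means that `S` is freely generated by vectors with disjoint supports.

*Cofreeness.* If `S` is closed under minima, then every exponent is uniquely the sum of an element
of `S` and an exponent that dominates no nonzero element of `S`, so that monomials form a basis of
`K[V]` over the invariants (`free_of_inf_mem`). Conversely, freeness implies flatness, and the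
equational criterion for flatness, applied to the relation between two invariant monomials given
by their least common multiple, shows that the quotients of the least common multiple by the two
monomials are invariant (`inf_mem_of_flat`).

*Stability.* A vector with support `I` is stable if and only if for every coordinate `j` some
invariant monomial involves `j` and otherwise only coordinates in `I` (`isStableVector_iff`). The
proof uses the Nullstellensatz and the divisibility of `Kˣ`, which allows one to find points of the
torus at which given characters have given values (`exists_character_eq`). Hence the components of
the strictly semistable locus are the coordinate subspaces of the maximal unstable supports
(`mem_components_iff`), and by purity they are hyperplanes `x i = 0`.

*Principal divisors.* The ideal of the image of a hyperplane `x i = 0` is spanned by the invariant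
monomials that involve `i`. It is principal if and only if there is a least one among the exponents
of these monomials (`imageIdeal_eq_span`, `hasLeast_of_isPrincipal`). If `V` is stable, then least
exponents exist for all coordinates if and only if `S` is closed under minima
(`hasLeast_of_inf_mem`, `inf_mem_of_hasLeast`). For the coordinates that do not define a component,
purity provides the least exponents (`hasLeast_of_isStableSupport`); in the opposite direction, the
least exponents imply purity (`isStableSupport_criticalSet`).
-/

namespace TorusRep

/-! ### Submonoids of exponent vectors -/

section Combinatorics

variable {ι : Type*}

/-- The combinatorial form of stability for a set `I` of coordinates, where `S` is the monoid of
exponents of invariant monomials: for every coordinate `j` there is an invariant monomial that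
involves `j` and otherwise only coordinates in `I`. For `j ∈ I` this says that orbits of vectors
with support `I` are closed, for `j ∉ I` that the `j`-th weight is in the rational span of the
weights in `I`. -/
def IsStableSupport (S : AddSubmonoid (ι →₀ ℕ)) (I : Set ι) : Prop :=
  ∀ j, ∃ a ∈ S, 0 < a j ∧ ∀ i, a i ≠ 0 → i ∈ I ∨ i = j

/-- Among the elements of `S` whose `i`-th coordinate is positive there is a least one. -/
def HasLeast (S : AddSubmonoid (ι →₀ ℕ)) (i : ι) : Prop :=
  ∃ s ∈ S, 0 < s i ∧ ∀ a ∈ S, 0 < a i → s ≤ a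

/-- The coordinates `i` for which `{i}ᶜ` is not a stable support, so that the hyperplane
`x i = 0` consists of vectors that are not stable. -/
def criticalSet (S : AddSubmonoid (ι →₀ ℕ)) : Set ι :=
  {i | ¬ IsStableSupport S {i}ᶜ}

variable {S : AddSubmonoid (ι →₀ ℕ)}

lemma IsStableSupport.mono {I J : Set ι} (h : IsStableSupport S I) (hIJ : I ⊆ J) :
    IsStableSupport S J := fun j => by
  obtain ⟨a, ha, haj, hI⟩ := h j
  exact ⟨a, ha, haj, fun i hi => (hI i hi).imp_left (@hIJ i)⟩

lemma hasLeast_of_inf_mem (hinf : ∀ s ∈ S, ∀ t ∈ S, s ⊓ t ∈ S) {i : ι}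
    (hi : ∃ a ∈ S, 0 < a i) : HasLeast S i := by
  obtain ⟨s, ⟨hs, hsi⟩, hmin⟩ :=
    (wellFounded_lt (α := ℕ)).onFun (f := fun a : ι →₀ ℕ => a.degree) |>.has_min
      {a | a ∈ S ∧ 0 < a i} (by obtain ⟨a, ha⟩ := hi; exact ⟨a, ha⟩)
  refine ⟨s, hs, hsi, fun a ha hai => ?_⟩
  have h1 := hmin (s ⊓ a) ⟨hinf s hs a ha, by simp [hsi, hai]⟩
  have h2 : s ⊓ a + (s - s ⊓ a) = s := add_tsub_cancel_of_le inf_le_left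
  have h3 : (s - s ⊓ a).degree = 0 := by
    have := congrArg Finsupp.degree h2
    rw [map_add] at this
    simp only [Function.onFun] at h1
    omega
  rw [Finsupp.degree_eq_zero_iff] at h3
  rw [h3, add_zero] at h2
  exact h2 ▸ inf_le_right

/-- If every coordinate has a least element, then `s ⊓ t ∈ S` by induction on `s`: a coordinate in
the support of `s ⊓ t` has a least element `u ≤ s ⊓ t`, and `u` can be subtracted from both. -/
lemma inf_mem_of_hasLeast (hS : ∀ s t, s ∈ S → s + t ∈ S → t ∈ S) (h : ∀ i, HasLeast S i) :
    ∀ s ∈ S, ∀ t ∈ S, s ⊓ t ∈ S := by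
  suffices H : ∀ n, ∀ s ∈ S, s.degree = n → ∀ t ∈ S, s ⊓ t ∈ S from
    fun s hs t ht => H _ s hs rfl t ht
  intro n
  induction n using Nat.strong_induction_on with
  | _ n ih =>
    intro s hs hn t ht
    by_cases h0 : s ⊓ t = 0
    · rw [h0]; exact S.zero_mem
    obtain ⟨i, hi⟩ := Finsupp.ne_iff.1 h0
    simp only [Finsupp.inf_apply, Finsupp.coe_zero, Pi.zero_apply] at hi
    obtain ⟨u, hu, hui, hmin⟩ := h i
    obtain ⟨s', rfl⟩ := exists_add_of_le (hmin s hs (by have := min_le_left (s i) (t i); omega))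
    obtain ⟨t', rfl⟩ := exists_add_of_le
      (hmin t ht (by have := min_le_right ((u + s') i) (t i); omega))
    have hs' := hS _ _ hu hs
    have ht' := hS _ _ hu ht
    have hu0 : 0 < u.degree := by
      rw [pos_iff_ne_zero, Ne, Finsupp.degree_eq_zero_iff]
      rintro rfl
      simp at hui
    rw [map_add] at hn
    have := S.add_mem hu (ih s'.degree (by omega) s' hs' rfl t' ht')
    convert this using 1
    ext j
    simp

/-- If all coordinates have least elements, then the critical coordinates form a stable support:
the least element for `j` involves besides `j` only critical coordinates. -/
lemma isStableSupport_criticalSet (h : ∀ i, HasLeast S i) :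
    IsStableSupport S (criticalSet S) := by
  intro j
  obtain ⟨s, hs, hsj, hmin⟩ := h j
  refine ⟨s, hs, hsj, fun i hi => ?_⟩
  by_contra! hc
  obtain ⟨hiU, hij⟩ := hc
  simp only [criticalSet, Set.mem_ofPred_eq, not_not] at hiU
  obtain ⟨a, ha, haj, hsupp⟩ := hiU j
  have hai : a i ≠ 0 := by
    have := hmin a ha haj i
    omega
  rcases hsupp i hai with h | h
  · exact h rfl
  · exact hij h

/-- If the coordinates in a stable support `U` have least elements and `S` is saturated, then all
coordinates do: for `j ∉ U`, subtracting the least elements of the coordinates in `U` as often as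
possible shows that a multiple of the `j`-th unit vector is in `S`. -/
lemma hasLeast_of_isStableSupport (hS : ∀ s t, s ∈ S → s + t ∈ S → t ∈ S)
    (hsat : ∀ (n : ℕ) (a : ι →₀ ℕ), n ≠ 0 → n • a ∈ S → a ∈ S) {U : Set ι}
    (hU : IsStableSupport S U) (h : ∀ i ∈ U, HasLeast S i) (j : ι) : HasLeast S j := by
  by_cases hj : j ∈ U
  · exact h j hj
  suffices hmem : Finsupp.single j 1 ∈ S by
    refine ⟨_, hmem, by simp, fun a ha haj => ?_⟩
    rw [Finsupp.single_le_iff]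
    exact haj
  obtain ⟨a, ⟨ha, haj, hsupp⟩, hmin⟩ :=
    (wellFounded_lt (α := ℕ)).onFun (f := fun a : ι →₀ ℕ => a.degree) |>.has_min
      {a | a ∈ S ∧ 0 < a j ∧ ∀ i, a i ≠ 0 → i ∈ U ∨ i = j} (hU j)
  have hzero : ∀ i, i ≠ j → a i = 0 := by
    intro i hij
    by_contra hi
    have hiU : i ∈ U := (hsupp i hi).resolve_right hij
    obtain ⟨s, hs, hsi, hsmin⟩ := h i hiU
    -- The support of `s` is contained in `U`, so that subtracting `s` does not affect `a j`.
    obtain ⟨c, hc, hci, hcU⟩ := hU i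
    have hsj : s j = 0 := by
      by_contra hsj
      have hcj : c j ≠ 0 := by
        have := hsmin c hc hci j
        omega
      rcases hcU j hcj with h | h
      · exact hj h
      · exact hij h.symm
    obtain ⟨a', rfl⟩ := exists_add_of_le (hsmin a ha (Nat.pos_of_ne_zero hi))
    refine hmin a' ⟨hS _ _ hs ha, ?_, fun k hk => hsupp k ?_⟩ ?_
    · simpa [hsj] using haj
    · rw [Finsupp.add_apply]; omega
    · have : 0 < s.degree := by
        rw [pos_iff_ne_zero, Ne, Finsupp.degree_eq_zero_iff]
        rintro rfl
        simp at hsi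
      simp only [Function.onFun, map_add]
      omega
  refine hsat (a j) _ haj.ne' ?_
  convert ha using 1
  ext i
  by_cases hij : i = j
  · subst hij; simp
  · simp [Ne.symm hij, hzero i hij]

end Combinatorics

/-! ### Freeness of a polynomial ring over a monoid algebra -/

section MonoidAlgebra

open MvPolynomial

variable {ι : Type*} (K : Type*) [Field K] (S : AddSubmonoid (ι →₀ ℕ))

/-- The polynomials all of whose exponents are in `S`; this is the monoid algebra `K[S]`. -/
def supportedIn : Subalgebra K (MvPolynomial ι K) where
  carrier := {p | ∀ a ∈ p.support, a ∈ S}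
  mul_mem' := by
    classical
    intro p q hp hq a ha
    obtain ⟨b, hb, c, hc, rfl⟩ := Finset.mem_add.1 (support_mul p q ha)
    exact S.add_mem (hp b hb) (hq c hc)
  add_mem' := by
    classical
    intro p q hp hq a ha
    rcases Finset.mem_union.1 (support_add ha) with h | h
    exacts [hp a h, hq a h]
  algebraMap_mem' := by
    classical
    intro c a ha
    rw [algebraMap_eq, mem_support_iff, coeff_C] at ha
    have : 0 = a := by by_contra h; simp [h] at ha
    exact this ▸ S.zero_mem

variable {K S}

lemma mem_supportedIn {p : MvPolynomial ι K} :
    p ∈ supportedIn K S ↔ ∀ a, coeff a p ≠ 0 → a ∈ S := by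
  simp only [← mem_support_iff]
  rfl

lemma monomial_mem_supportedIn {a : ι →₀ ℕ} (ha : a ∈ S) (c : K) :
    monomial a c ∈ supportedIn K S := by
  classical
  rw [mem_supportedIn]
  intro b hb
  rw [coeff_monomial] at hb
  have : a = b := by by_contra h; simp [h] at hb
  exact this ▸ ha

/-- An exponent of a product `p * q` with `p ∈ K[S]` is the sum of an element of `S` and an
exponent of `q`. -/
lemma exists_add_of_coeff_mul_ne_zero {p q : MvPolynomial ι K} {d : ι →₀ ℕ}
    (h : coeff d (p * q) ≠ 0) : ∃ u y, coeff u p ≠ 0 ∧ coeff y q ≠ 0 ∧ u + y = d := by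
  classical
  obtain ⟨u, hu, y, hy, rfl⟩ := Finset.mem_add.1 (support_mul p q (mem_support_iff.2 h))
  exact ⟨u, y, mem_support_iff.1 hu, mem_support_iff.1 hy, rfl⟩

/-- If `K[x]` is flat over `K[S]`, then `S` is closed under coordinatewise minima. The equational
criterion, applied to `x ^ s * x ^ b = x ^ t * x ^ c` with `b = s ⊔ t - s` and `c = s ⊔ t - t`,
yields `u, u' ∈ S` and `y` with `b = u + y` and `c = u' + y`. As `b ⊓ c = 0`, this gives
`y = 0`, hence `b ∈ S` and `c ∈ S`. -/
lemma inf_mem_of_flat (hS : ∀ s t, s ∈ S → s + t ∈ S → t ∈ S)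
    [Module.Flat (supportedIn K S) (MvPolynomial ι K)] :
    ∀ s ∈ S, ∀ t ∈ S, s ⊓ t ∈ S := by
  classical
  intro s hs t ht
  set b : ι →₀ ℕ := s ⊔ t - s with hb
  set c : ι →₀ ℕ := s ⊔ t - t with hc
  have hsb : s + b = s ⊔ t := add_tsub_cancel_of_le le_sup_left
  have htc : t + c = s ⊔ t := add_tsub_cancel_of_le le_sup_right
  let f : Fin 2 → supportedIn K S :=
    ![⟨monomial s 1, monomial_mem_supportedIn hs 1⟩,
      ⟨monomial t (-1), monomial_mem_supportedIn ht (-1)⟩]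
  let x : Fin 2 → MvPolynomial ι K := ![monomial b 1, monomial c 1]
  have hrel : Module.IsTrivialRelation f x := by
    refine Module.Flat.isTrivialRelation_of_sum_smul_eq_zero ?_
    simp only [Fin.sum_univ_two, f, x, Matrix.cons_val_zero, Matrix.cons_val_one,
      Subalgebra.smul_def, smul_eq_mul, monomial_mul, hsb, htc]
    rw [← map_add]
    simp
  obtain ⟨k, a, y, hx, ha⟩ := hrel
  have hb1 : coeff b (∑ j, (a 0 j : MvPolynomial ι K) * y j) ≠ 0 := by
    have := hx 0
    simp only [Subalgebra.smul_def, smul_eq_mul] at this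
    rw [← this]
    simp [x, coeff_monomial]
  rw [coeff_sum] at hb1
  obtain ⟨j, -, hj⟩ := Finset.exists_ne_zero_of_sum_ne_zero hb1
  obtain ⟨u, w, hu, hw, huw⟩ := exists_add_of_coeff_mul_ne_zero hj
  have huS : u ∈ S := mem_supportedIn.1 (a 0 j).2 u hu
  have hj2 := congrArg (fun p : supportedIn K S => coeff (s + u) (p : MvPolynomial ι K)) (ha j)
  simp only [Fin.sum_univ_two, f, Matrix.cons_val_zero, Matrix.cons_val_one,
    Subalgebra.coe_add, Subalgebra.coe_mul, coeff_add, coeff_monomial_mul, one_mul,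
    Subalgebra.coe_zero, coeff_zero] at hj2
  have hne : coeff (s + u) (monomial t (-1) * (a 1 j : MvPolynomial ι K)) ≠ 0 := by
    intro h0
    rw [h0, add_zero] at hj2
    exact hu hj2
  obtain ⟨t', u', ht', hu', htu⟩ := exists_add_of_coeff_mul_ne_zero hne
  rw [coeff_monomial] at ht'
  obtain rfl : t = t' := by by_contra h; simp [h] at ht'
  have hu'S : u' ∈ S := mem_supportedIn.1 (a 1 j).2 u' hu'
  have hc' : u' + w = c := by
    have : t + (u' + w) = t + c := by
      rw [← add_assoc, htu, htc, ← hsb, add_assoc, huw]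
    exact add_left_cancel this
  have hw0 : w = 0 := by
    ext i
    have h1 := DFunLike.congr_fun huw i
    have h2 := DFunLike.congr_fun hc' i
    simp only [hb, hc, Finsupp.add_apply, Finsupp.tsub_apply, Finsupp.sup_apply,
      Finsupp.coe_zero, Pi.zero_apply] at h1 h2 ⊢
    omega
  rw [hw0, add_zero] at hc'
  refine hS c _ (hc' ▸ hu'S) ?_
  convert hs using 1
  ext i
  simp only [hc, Finsupp.add_apply, Finsupp.tsub_apply, Finsupp.sup_apply, Finsupp.inf_apply]
  omega

variable (S) in
/-- An exponent is reduced if it dominates no nonzero element of `S`. -/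
def IsReducedExponent (b : ι →₀ ℕ) : Prop := ∀ s ∈ S, s ≤ b → s = 0

/-- If `S` is closed under coordinatewise minima, then the decomposition of an exponent as the sum
of an element of `S` and a reduced exponent is unique: after subtracting `s ⊓ t` from `s` and
`t`, an inequality `s ≤ t + c` implies `s ≤ c`. -/
lemma eq_of_add_eq_add_of_isReducedExponent (hS : ∀ s t, s ∈ S → s + t ∈ S → t ∈ S)
    (hinf : ∀ s ∈ S, ∀ t ∈ S, s ⊓ t ∈ S) {s t b c : ι →₀ ℕ} (hs : s ∈ S) (ht : t ∈ S)
    (hb : IsReducedExponent S b) (hc : IsReducedExponent S c) (h : s + b = t + c) : b = c := by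
  have key : ∀ {s t b c : ι →₀ ℕ}, s ∈ S → t ∈ S → IsReducedExponent S c → s + b = t + c →
      s ≤ t := by
    intro s t b c hs ht hc h
    have h1 : s ⊓ t + (s - s ⊓ t) = s := add_tsub_cancel_of_le inf_le_left
    have h2 : s - s ⊓ t ∈ S := hS _ _ (hinf s hs t ht) (by rwa [h1])
    have h3 : s - s ⊓ t = 0 := by
      refine hc _ h2 fun i => ?_
      have := DFunLike.congr_fun h i
      simp only [Finsupp.add_apply, Finsupp.tsub_apply, Finsupp.inf_apply] at this ⊢
      omega
    rw [h3, add_zero] at h1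
    exact h1 ▸ inf_le_right
  obtain rfl := le_antisymm (key hs ht hc h) (key ht hs hb h.symm)
  exact add_left_cancel h

lemma exists_add_isReducedExponent (d : ι →₀ ℕ) :
    ∃ s ∈ S, ∃ b, IsReducedExponent S b ∧ s + b = d := by
  induction hn : d.degree using Nat.strong_induction_on generalizing d with
  | _ n ih =>
    by_cases hd : IsReducedExponent S d
    · exact ⟨0, S.zero_mem, d, hd, zero_add d⟩
    · simp only [IsReducedExponent, not_forall] at hd
      obtain ⟨u, hu, hud, hu0⟩ := hd
      obtain ⟨d', rfl⟩ := exists_add_of_le hud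
      have : 0 < u.degree := by
        rw [pos_iff_ne_zero, Ne, Finsupp.degree_eq_zero_iff]
        exact hu0
      rw [map_add] at hn
      obtain ⟨s, hs, b, hb, rfl⟩ := ih d'.degree (by omega) d' rfl
      exact ⟨u + s, S.add_mem hu hs, b, hb, add_assoc _ _ _⟩

/-- If `S` is closed under coordinatewise minima, then the monomials with reduced exponents are a
basis of `K[x]` over `K[S]`. -/
lemma free_of_inf_mem (hS : ∀ s t, s ∈ S → s + t ∈ S → t ∈ S)
    (hinf : ∀ s ∈ S, ∀ t ∈ S, s ⊓ t ∈ S) :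
    Module.Free (supportedIn K S) (MvPolynomial ι K) := by
  let v : {b // IsReducedExponent S b} → MvPolynomial ι K := fun b => monomial b.1 1
  refine Module.Free.of_basis (Module.Basis.mk (v := v) ?_ ?_)
  · rw [linearIndependent_iff']
    intro F g hg b hbF
    ext s
    by_contra hne
    simp only [ZeroMemClass.coe_zero, coeff_zero] at hne
    have hs := mem_supportedIn.1 (g b).2 s hne
    have h1 := congrArg (coeff (s + b.1)) hg
    rw [coeff_sum, Finset.sum_eq_single b] at h1
    · simp only [v, Subalgebra.smul_def, smul_eq_mul, coeff_zero] at h1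
      rw [coeff_mul_monomial, mul_one] at h1
      exact hne h1
    · intro c _ hcb
      by_contra h
      simp only [v, Subalgebra.smul_def, smul_eq_mul] at h
      obtain ⟨t, y, ht, hy, hty⟩ := exists_add_of_coeff_mul_ne_zero h
      classical
      rw [coeff_monomial] at hy
      obtain rfl : c.1 = y := by by_contra h; simp [h] at hy
      exact hcb (Subtype.ext (eq_of_add_eq_add_of_isReducedExponent hS hinf
        (mem_supportedIn.1 (g c).2 t ht) hs c.2 b.2 hty))
    · exact fun h => absurd hbF h
  · intro p _
    induction p using MvPolynomial.induction_on' with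
    | monomial d c =>
      obtain ⟨s, hs, b, hb, rfl⟩ := exists_add_isReducedExponent (S := S) d
      have : monomial (s + b) c =
          (⟨monomial s c, monomial_mem_supportedIn hs c⟩ : supportedIn K S) • v ⟨b, hb⟩ := by
        simp [v, Subalgebra.smul_def, monomial_mul]
      rw [this]
      exact Submodule.smul_mem _ _ (Submodule.subset_span ⟨_, rfl⟩)
    | add p q hp hq => exact Submodule.add_mem _ (hp trivial) (hq trivial)

end MonoidAlgebra

/-! ### Characters of the torus -/

section Characters

variable {K : Type*} [Field K] {r : ℕ}

variable (K) in
/-- The character `t ↦ t ^ m` of the torus with exponent vector `m`. -/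
def character (m : Fin r → ℤ) : (Fin r → Kˣ) →* Kˣ where
  toFun t := ∏ i, t i ^ m i
  map_one' := by simp
  map_mul' s t := by simp [mul_zpow, Finset.prod_mul_distrib]

lemma character_apply (m : Fin r → ℤ) (t : Fin r → Kˣ) :
    character K m t = ∏ i, t i ^ m i := rfl

@[simp]
lemma character_zero (t : Fin r → Kˣ) : character K 0 t = 1 := by
  simp [character_apply]

lemma character_add (m n : Fin r → ℤ) (t : Fin r → Kˣ) :
    character K (m + n) t = character K m t * character K n t := by
  simp [character_apply, zpow_add, Finset.prod_mul_distrib]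

lemma character_weight {ι : Type*} (χ : ι → Fin r → ℤ) (a : ι →₀ ℕ) (t : Fin r → Kˣ) :
    character K (Finsupp.weight χ a) t = a.prod fun i n => character K (χ i) t ^ n := by
  classical
  induction a using Finsupp.induction_linear with
  | zero => simp
  | add a b ha hb =>
    rw [map_add, character_add, ha, hb, Finsupp.prod_add_index' (by simp) (by simp [pow_add])]
  | single i n =>
    simp [Finsupp.weight_apply, character_apply, zpow_mul', Finset.prod_pow]

/-- Distinct exponent vectors give distinct characters; powers of `2` tell them apart. -/
lemma character_injective [CharZero K] : Function.Injective (character K : (Fin r → ℤ) → _) := by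
  intro m n h
  ext k
  let two : Kˣ := Units.mk0 2 two_ne_zero
  have h1 := DFunLike.congr_fun h (Function.update (1 : Fin r → Kˣ) k two)
  have h2 : ∀ m : Fin r → ℤ, character K m (Function.update 1 k two) = two ^ m k := by
    intro m
    rw [character_apply, Finset.prod_eq_single k] <;> simp +contextual [Function.update_of_ne]
  rw [h2, h2] at h1
  have h3 : ((2 : ℚ) : K) ^ m k = ((2 : ℚ) : K) ^ n k := by
    simpa [two] using congrArg (Units.val) h1
  have h4 : (2 : ℚ) ^ m k = 2 ^ n k := by exact_mod_cast h3
  exact zpow_right_injective₀ (by norm_num) (by norm_num) h4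

lemma linearIndependent_character [CharZero K] :
    LinearIndependent K fun (m : Fin r → ℤ) (t : Fin r → Kˣ) => (character K m t : K) := by
  have h := linearIndependent_monoidHom (Fin r → Kˣ) K
  refine h.comp (fun m => (Units.coeHom K).comp (character K m)) fun m n hmn => ?_
  refine character_injective (K := K) (MonoidHom.ext fun t => Units.ext ?_)
  exact DFunLike.congr_fun hmn t

end Characters

/-! ### Weight bases -/

section Diagonalization

variable {K : Type*} [Field K] [CharZero K] {V : Type*} [AddCommGroup V] [Module K V]
  [FiniteDimensional K V] {r : ℕ} {ρ : Representation K (Fin r → Kˣ) V}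

/-- Every vector is a sum of weight vectors: the coefficients of the Laurent polynomial
`t ↦ ρ t v` are weight vectors by linear independence of characters, and they sum up
to `ρ 1 v = v`. -/
lemma mem_span_weightVectors (halg : IsAlgebraic ρ) (v : V) :
    v ∈ Submodule.span K {w | ∃ m, ∀ t, ρ t w = (character K m t : K) • w} := by
  classical
  let B := Module.finBasis K V
  choose c hc using fun k => halg (B.coord k) v
  let F : Finset (Fin r → ℤ) := Finset.univ.biUnion fun k => (c k).support
  let w : (Fin r → ℤ) → V := fun m => ∑ k, c k m • B k
  have hρ : ∀ t, ρ t v = ∑ m ∈ F, (character K m t : K) • w m := by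
    intro t
    rw [← B.sum_repr (ρ t v)]
    simp only [w, Finset.smul_sum]
    rw [Finset.sum_comm]
    refine Finset.sum_congr rfl fun k _ => ?_
    have h1 : B.repr (ρ t v) k = (c k).sum fun m a => a * (character K m t : K) := hc k t
    rw [h1, Finsupp.sum_of_support_subset (s := F) _
      (Finset.subset_biUnion_of_mem (fun k => (c k).support) (Finset.mem_univ k)) _ (by simp),
      Finset.sum_smul]
    refine Finset.sum_congr rfl fun m _ => ?_
    rw [smul_smul, mul_comm]
  have hw : ∀ m ∈ F, ∀ s, ρ s (w m) = (character K m s : K) • w m := by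
    intro m hm s
    refine B.ext_elem fun k => ?_
    rw [← sub_eq_zero]
    refine linearIndependent_iff'.1 (linearIndependent_character (K := K) (r := r)) F
      (fun m => B.repr (ρ s (w m)) k - B.repr ((character K m s : K) • w m) k) ?_ m hm
    ext t
    have h1 : ρ s (ρ t v) = ρ (s * t) v := by rw [map_mul]; rfl
    rw [hρ, hρ, map_sum] at h1
    have h2 := congrArg (fun x => B.repr x k) h1
    simp only [map_sum, map_smul, map_mul, Units.val_mul, Finsupp.coe_finsetSum,
      Finset.sum_apply, Finsupp.smul_apply, smul_eq_mul] at h2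
    simp only [Finset.sum_apply, Pi.smul_apply, smul_eq_mul, map_smul, Finsupp.smul_apply,
      Pi.zero_apply, sub_mul, Finset.sum_sub_distrib, sub_eq_zero]
    convert h2 using 2 <;> ring
  have h1 := hρ 1
  simp only [map_one, Module.End.one_apply, Units.val_one, one_smul] at h1
  rw [h1]
  exact Submodule.sum_mem _ fun m hm => Submodule.subset_span ⟨m, hw m hm⟩

/-- Algebraic representations of a torus are diagonalizable. -/
lemma exists_weightBasis (halg : IsAlgebraic ρ) :
    ∃ (s : Set V) (b : Module.Basis s K V) (χ : s → Fin r → ℤ),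
      ∀ i t, ρ t (b i) = (character K (χ i) t : K) • b i := by
  have hspan : ⊤ ≤ Submodule.span K {w | ∃ m, ∀ t, ρ t w = (character K m t : K) • w} :=
    fun v _ => mem_span_weightVectors halg v
  have h := fun i => Module.Basis.ofSpan_subset hspan ⟨i, rfl⟩
  choose χ hχ using h
  exact ⟨_, Module.Basis.ofSpan hspan, χ, hχ⟩

end Diagonalization

/-! ### Coordinates and invariants -/

section Coordinates

open MvPolynomial

variable {K : Type*} [Field K] {V : Type*} [AddCommGroup V] [Module K V]
  {ι : Type*} (b : Module.Basis ι K V)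

/-- A polynomial in the coordinates with respect to a basis, as a function on the space. -/
noncomputable def toFunction : MvPolynomial ι K →ₐ[K] (V → K) :=
  aeval fun i => (b.coord i : V → K)

lemma toFunction_apply (p : MvPolynomial ι K) (v : V) :
    toFunction b p v = eval (b.repr v) p := by
  have : (Pi.evalAlgHom K (fun _ : V => K) v).comp (toFunction b) = aeval (b.repr v) := by
    refine MvPolynomial.algHom_ext fun i => ?_
    simp [toFunction]
  exact DFunLike.congr_fun this p

variable [Finite ι]

lemma range_toFunction : (toFunction b).range = coordRing K V := by
  rw [toFunction, ← Algebra.adjoin_range_eq_range_aeval]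
  apply le_antisymm
  · refine Algebra.adjoin_mono ?_
    rintro _ ⟨i, rfl⟩
    exact ⟨b.coord i, rfl⟩
  · refine Algebra.adjoin_le ?_
    rintro _ ⟨l, rfl⟩
    have := Fintype.ofFinite ι
    have h : (l : V → K) = ∑ i, l (b i) • (b.coord i : V → K) := by
      ext v
      conv_lhs => rw [← b.sum_repr v, map_sum]
      simp [mul_comm]
    change (l : V → K) ∈ Algebra.adjoin K (Set.range fun i => (b.coord i : V → K))
    rw [h]
    exact Subalgebra.sum_mem _ fun i _ =>
      Subalgebra.smul_mem _ (Algebra.subset_adjoin (Set.mem_range_self i)) _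

lemma repr_equivFun_symm [Fintype ι] (x : ι → K) : ⇑(b.repr (b.equivFun.symm x)) = x :=
  b.equivFun.apply_symm_apply x

variable [Infinite K]

lemma toFunction_injective : Function.Injective (toFunction b) := by
  have := Fintype.ofFinite ι
  intro p q h
  refine MvPolynomial.funext fun x => ?_
  have := congrFun h (b.equivFun.symm x)
  rwa [toFunction_apply, toFunction_apply, repr_equivFun_symm] at this

/-- The choice of a basis of `V` identifies `K[V]` with a polynomial ring. -/
noncomputable def coordEquiv : MvPolynomial ι K ≃ₐ[K] coordRing K V :=
  (AlgEquiv.ofInjective (toFunction b) (toFunction_injective b)).trans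
    (Subalgebra.equivOfEq _ _ (range_toFunction b))

lemma coordEquiv_apply (p : MvPolynomial ι K) (v : V) :
    (coordEquiv b p).1 v = eval (b.repr v) p :=
  toFunction_apply b p v

end Coordinates

section Invariants

open MvPolynomial

variable {K : Type*} [Field K] {V : Type*} [AddCommGroup V] [Module K V] {r : ℕ}
  {ρ : Representation K (Fin r → Kˣ) V} {ι : Type*} {b : Module.Basis ι K V}
  {χ : ι → Fin r → ℤ}

/-- The exponents of the monomials that are invariant under a torus acting with weights `χ`. -/
noncomputable def exponents (χ : ι → Fin r → ℤ) : AddSubmonoid (ι →₀ ℕ) :=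
  AddMonoidHom.mker (Finsupp.weight χ)

lemma mem_exponents {a : ι →₀ ℕ} : a ∈ exponents χ ↔ Finsupp.weight χ a = 0 := Iff.rfl

lemma exponents_cancel (s t : ι →₀ ℕ) (hs : s ∈ exponents χ) (hst : s + t ∈ exponents χ) :
    t ∈ exponents χ := by
  rw [mem_exponents] at *
  rwa [map_add, hs, zero_add] at hst

lemma exponents_saturated (n : ℕ) (a : ι →₀ ℕ) (hn : n ≠ 0) (h : n • a ∈ exponents χ) :
    a ∈ exponents χ := by
  rw [mem_exponents] at *
  rw [map_nsmul] at h
  exact (smul_eq_zero.1 h).resolve_left hn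

lemma repr_apply (hχ : ∀ i t, ρ t (b i) = (character K (χ i) t : K) • b i) (t : Fin r → Kˣ)
    (v : V) (i : ι) : b.repr (ρ t v) i = character K (χ i) t * b.repr v i := by
  have : b.coord i ∘ₗ ρ t = (character K (χ i) t : K) • b.coord i := by
    refine b.ext fun j => ?_
    by_cases h : j = i
    · subst h; simp [hχ]
    · simp [hχ, h]
  exact DFunLike.congr_fun this v

lemma prod_repr_apply (hχ : ∀ i t, ρ t (b i) = (character K (χ i) t : K) • b i)
    (t : Fin r → Kˣ) (v : V) (a : ι →₀ ℕ) :
    ∏ i ∈ a.support, b.repr (ρ t v) i ^ a i =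
      character K (Finsupp.weight χ a) t * ∏ i ∈ a.support, b.repr v i ^ a i := by
  simp only [repr_apply hχ, mul_pow, Finset.prod_mul_distrib, character_weight, Finsupp.prod,
    Units.coe_prod, Units.val_pow_eq_pow_val]

variable [CharZero K] [Finite ι]

/-- A polynomial function is invariant if and only if all its monomials are. -/
lemma coordEquiv_mem_invariantRing
    (hχ : ∀ i t, ρ t (b i) = (character K (χ i) t : K) • b i) (p : MvPolynomial ι K) :
    coordEquiv b p ∈ invariantRing ρ ↔ p ∈ supportedIn K (exponents χ) := by
  classical
  have := Fintype.ofFinite ι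
  rw [mem_supportedIn]
  constructor
  · intro h a ha
    refine character_injective (K := K) (MonoidHom.ext fun t => Units.ext ?_)
    -- Translating by `t` multiplies the coefficient of `x ^ a` by the weight of `a` at `t`.
    have key :
        ∑ d ∈ p.support, monomial d (coeff d p * character K (Finsupp.weight χ d) t) = p := by
      refine MvPolynomial.funext fun x => ?_
      have h1 := h t (b.equivFun.symm x)
      rw [coordEquiv_apply, coordEquiv_apply, eval_eq, eval_eq] at h1
      simp only [prod_repr_apply hχ, repr_equivFun_symm] at h1
      rw [map_sum, eval_eq x p, ← h1]
      refine Finset.sum_congr rfl fun d _ => ?_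
      rw [eval_monomial, mul_assoc, Finsupp.prod]
    have h1 := congrArg (coeff a) key
    simp only [coeff_sum, coeff_monomial] at h1
    rw [Finset.sum_ite_eq', if_pos (mem_support_iff.2 ha)] at h1
    simpa [ha] using h1
  · intro h t v
    rw [coordEquiv_apply, coordEquiv_apply, eval_eq, eval_eq]
    refine Finset.sum_congr rfl fun d hd => ?_
    rw [prod_repr_apply hχ, mem_exponents.1 (h d (mem_support_iff.1 hd)), character_zero,
      Units.val_one, one_mul]

/-- The restriction of `coordEquiv` to the invariants. -/
noncomputable def invariantEquiv
    (hχ : ∀ i t, ρ t (b i) = (character K (χ i) t : K) • b i) :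
    supportedIn K (exponents χ) ≃+* invariantRing ρ where
  toFun p := ⟨coordEquiv b p, (coordEquiv_mem_invariantRing hχ _).2 p.2⟩
  invFun f := ⟨(coordEquiv b).symm f, (coordEquiv_mem_invariantRing hχ _).1 (by simp)⟩
  left_inv p := by simp
  right_inv f := by simp
  map_mul' p q := Subtype.ext (by simp)
  map_add' p q := Subtype.ext (by simp)

/-- Cofreeness is a property of the monoid of exponents of invariant monomials. -/
lemma isCofree_iff_inf_mem (hχ : ∀ i t, ρ t (b i) = (character K (χ i) t : K) • b i) :
    IsCofree ρ ↔ ∀ s ∈ exponents χ, ∀ t ∈ exponents χ, s ⊓ t ∈ exponents χ := by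
  let e := invariantEquiv hχ
  have := RingHomInvPair.of_ringEquiv e
  have := RingHomInvPair.of_ringEquiv_symm e
  let E : MvPolynomial ι K ≃ₛₗ[(e : supportedIn K (exponents χ) →+* invariantRing ρ)]
      coordRing K V :=
    { (coordEquiv b).toRingEquiv.toAddEquiv with
      map_smul' := fun p q => by
        simp only [Subalgebra.smul_def, smul_eq_mul]
        exact map_mul (coordEquiv b) _ _ }
  rw [IsCofree, ← Module.Free.iff_of_equiv E]
  exact ⟨fun _ => inf_mem_of_flat (K := K) exponents_cancel, free_of_inf_mem exponents_cancel⟩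

end Invariants

/-! ### Prescribing values of characters -/

section Extension

variable {K : Type*} [Field K] [IsAlgClosed K] {r : ℕ} {ι : Type*} {χ : ι → Fin r → ℤ}

variable (K) in
lemma baer_additive_units : Module.Baer ℤ (Additive Kˣ) := by
  let : DivisibleBy (Additive Kˣ) ℕ := divisibleByOfSMulRightSurj _ _ fun {n} hn x => by
    obtain ⟨z, hz⟩ := IsAlgClosed.exists_pow_nat_eq (x.toMul : K) (Nat.pos_of_ne_zero hn)
    have hz0 : z ≠ 0 := by
      rintro rfl
      rw [zero_pow hn] at hz
      exact x.toMul.ne_zero hz.symm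
    refine ⟨Additive.ofMul (Units.mk0 z hz0), ?_⟩
    refine Additive.toMul.injective (Units.ext ?_)
    simpa using hz
  let := AddGroup.divisibleByIntOfDivisibleByNat (Additive Kˣ)
  exact Module.Baer.of_divisible _

/-- The inclusion of natural into integral exponent vectors. -/
noncomputable def natToInt : (ι →₀ ℕ) →+ (ι →₀ ℤ) :=
  Finsupp.mapRange.addMonoidHom (Nat.castAddMonoidHom ℤ)

lemma linearCombination_natToInt {N : Type*} [AddCommGroup N] (χ : ι → N) (a : ι →₀ ℕ) :
    Finsupp.linearCombination ℤ χ (natToInt a) = Finsupp.weight χ a := by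
  induction a using Finsupp.induction_linear with
  | zero => simp
  | add a b ha hb => simp only [map_add, ha, hb]
  | single i n => simp [natToInt, Finsupp.weight_apply]

/-- Values `c i` at the characters `χ i`, `i ∈ J`, are taken at some point of the torus if they
satisfy all multiplicative relations between these characters. The reason is that `Kˣ` is
divisible: a homomorphism to `Kˣ` extends from the subgroup of `ℤ ^ r` generated by the `χ i` to
`ℤ ^ r`. -/
lemma exists_character_eq (J : Set ι) (c : ι → Kˣ)
    (hc : ∀ a a' : ι →₀ ℕ, (∀ i, a i ≠ 0 → i ∈ J) → (∀ i, a' i ≠ 0 → i ∈ J) →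
      Finsupp.weight χ a = Finsupp.weight χ a' →
      (a.prod fun i n => c i ^ n) = a'.prod fun i n => c i ^ n) :
    ∃ t : Fin r → Kˣ, ∀ i ∈ J, character K (χ i) t = c i := by
  let P := Finsupp.supported ℤ ℤ J
  let φ : P →ₗ[ℤ] (Fin r → ℤ) := (Finsupp.linearCombination ℤ χ).domRestrict P
  let ψ : P →ₗ[ℤ] Additive Kˣ :=
    (Finsupp.linearCombination ℤ fun i => Additive.ofMul (c i)).domRestrict P
  have hker : LinearMap.ker φ ≤ LinearMap.ker ψ := by
    rintro ⟨l, hl⟩ hφ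
    have hl' : ∀ i, l i ≠ 0 → i ∈ J := fun i hi => hl (Finsupp.mem_support_iff.2 hi)
    let a : ι →₀ ℕ := l.mapRange Int.toNat rfl
    let a' : ι →₀ ℕ := (-l).mapRange Int.toNat rfl
    have hla : l = natToInt a - natToInt a' := by
      ext i
      simp [natToInt, a, a']
    have hw := hc a a' (fun i hi => hl' i fun h => hi (by simp [a, h]))
      (fun i hi => hl' i fun h => hi (by simp [a', h])) (by
        have : Finsupp.linearCombination ℤ χ l = 0 := hφ
        rwa [hla, map_sub, linearCombination_natToInt, linearCombination_natToInt,
          sub_eq_zero] at this)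
    change Finsupp.linearCombination ℤ (fun i => Additive.ofMul (c i)) l = 0
    rw [hla, map_sub, linearCombination_natToInt, linearCombination_natToInt, sub_eq_zero]
    exact congrArg Additive.ofMul hw
  obtain ⟨h, hh⟩ := (baer_additive_units K).extension_property
    ((LinearMap.ker φ).liftQ φ le_rfl)
    (LinearMap.ker_eq_bot.1 (Submodule.ker_liftQ_eq_bot _ _ _ le_rfl))
    ((LinearMap.ker φ).liftQ ψ hker)
  have hφψ : ∀ x, h (φ x) = ψ x := fun x => DFunLike.congr_fun hh (Submodule.Quotient.mk x)
  let t : Fin r → Kˣ := fun k => (h (Pi.single k 1)).toMul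
  have ht : ∀ m, Additive.ofMul (character K m t) = h m := by
    intro m
    rw [character_apply, ofMul_prod]
    conv_rhs => rw [pi_eq_sum_univ' m, map_sum]
    refine Finset.sum_congr rfl fun k _ => ?_
    rw [map_smul, ofMul_zpow]
    rfl
  refine ⟨t, fun i hi => Additive.ofMul.injective ?_⟩
  have hx := hφψ ⟨Finsupp.single i 1, Finsupp.single_mem_supported ℤ 1 hi⟩
  simp only [φ, ψ, LinearMap.domRestrict_apply, Finsupp.linearCombination_single, one_smul] at hx
  rw [ht, hx]

end Extension

/-! ### The Zariski topology and stable vectors -/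

section Zariski

variable {K : Type*} [Field K] {V : Type*} [AddCommGroup V] [Module K V]

lemma isClosed_zariski_iff {Z : Set V} :
    IsClosed[zariski K V] Z ↔ ∃ S : Set (coordRing K V), zeroLocus S = Z := by
  rw [← @isOpen_compl_iff V Z (zariski K V)]
  change Zᶜᶜ ∈ Set.range zeroLocus ↔ _
  rw [compl_compl]
  rfl

lemma mem_closure_zariski_iff {Z : Set V} {v : V} :
    v ∈ closure[zariski K V] Z ↔ ∀ f : coordRing K V, (∀ z ∈ Z, f.1 z = 0) → f.1 v = 0 := by
  simp only [closure, Set.mem_sInter, Set.mem_ofPred_eq, isClosed_zariski_iff]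
  constructor
  · intro h f hf
    exact h (zeroLocus {f}) ⟨⟨_, rfl⟩, fun z hz g hg => by rw [hg]; exact hf z hz⟩ f rfl
  · rintro h _ ⟨⟨S, rfl⟩, hS⟩ f hf
    exact h f fun z hz => hS hz f hf

end Zariski

section Stability

open MvPolynomial

variable {K : Type*} [Field K] {V : Type*} [AddCommGroup V] [Module K V] {r : ℕ}
  {ρ : Representation K (Fin r → Kˣ) V} {ι : Type*} {b : Module.Basis ι K V}
  {χ : ι → Fin r → ℤ}

lemma apply_mem_orbit {v w : V} (t : Fin r → Kˣ) (h : v ∈ orbit ρ w) : ρ t v ∈ orbit ρ w := by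
  obtain ⟨s, rfl⟩ := h
  exact ⟨t * s, by simp⟩

lemma mem_orbit_self (v : V) : v ∈ orbit ρ v := ⟨1, by simp⟩

lemma mem_orbit_symm {v w : V} (h : v ∈ orbit ρ w) : w ∈ orbit ρ v := by
  obtain ⟨t, rfl⟩ := h
  exact ⟨t⁻¹, by
    change (ρ t⁻¹ * ρ t) w = w
    rw [← map_mul, inv_mul_cancel, map_one, Module.End.one_apply]⟩

lemma orbit_eq_of_mem {v w : V} (h : v ∈ orbit ρ w) : orbit ρ w = orbit ρ v := by
  apply le_antisymm
  · rintro _ ⟨t, rfl⟩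
    exact apply_mem_orbit t (mem_orbit_symm h)
  · rintro _ ⟨t, rfl⟩
    exact apply_mem_orbit t h

/-- The support of a vector with respect to a basis. -/
def basisSupport (b : Module.Basis ι K V) (v : V) : Set ι := {i | b.repr v i ≠ 0}

/-- If every coordinate in `I` occurs in an invariant monomial that involves only coordinates in
`I`, then every monomial in these coordinates divides such an invariant monomial. -/
lemma exists_add_mem {S : AddSubmonoid (ι →₀ ℕ)} {I : Set ι}
    (hI : ∀ j ∈ I, ∃ a ∈ S, 0 < a j ∧ ∀ i, a i ≠ 0 → i ∈ I) (a : ι →₀ ℕ)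
    (ha : ∀ i, a i ≠ 0 → i ∈ I) : ∃ d, (∀ i, d i ≠ 0 → i ∈ I) ∧ a + d ∈ S := by
  induction a using Finsupp.induction_linear with
  | zero => exact ⟨0, by simp, by simp⟩
  | add a a' h h' =>
    obtain ⟨d, hd, hS⟩ := h fun i hi => ha i (by rw [Finsupp.add_apply]; omega)
    obtain ⟨d', hd', hS'⟩ := h' fun i hi => ha i (by rw [Finsupp.add_apply]; omega)
    refine ⟨d + d', fun i hi => ?_, by rw [add_add_add_comm]; exact S.add_mem hS hS'⟩
    rw [Finsupp.add_apply] at hi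
    rcases Nat.eq_zero_or_pos (d i) with h | h
    · exact hd' i (by omega)
    · exact hd i h.ne'
  | single i n =>
    rcases Nat.eq_zero_or_pos n with rfl | hn
    · exact ⟨0, by simp, by simp⟩
    obtain ⟨s, hs, hsi, hsI⟩ := hI i (ha i (by simp [hn.ne']))
    refine ⟨n • s - Finsupp.single i n, fun k hk => hsI k fun h => hk (by simp [h]), ?_⟩
    rw [add_tsub_cancel_of_le]
    · exact S.nsmul_mem hs n
    · rw [Finsupp.single_le_iff]
      exact Nat.le_mul_of_pos_right n hsi

lemma prod_ne_zero_iff (v : V) (a : ι →₀ ℕ) :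
    ∏ i ∈ a.support, b.repr v i ^ a i ≠ 0 ↔ ∀ i, a i ≠ 0 → i ∈ basisSupport b v := by
  rw [Finset.prod_ne_zero_iff]
  refine forall_congr' fun i => ?_
  rw [Finsupp.mem_support_iff]
  exact imp_congr_right fun hi => pow_ne_zero_iff hi

section Closure

variable [CharZero K] [Finite ι]

/-- Polynomial functions in coordinates that vanish on a set vanish on its closure. -/
lemma eval_eq_zero_of_mem_closure {Z : Set V} {w : V} (hw : w ∈ closure[zariski K V] Z)
    (p : MvPolynomial ι K) (hp : ∀ z ∈ Z, eval (b.repr z) p = 0) : eval (b.repr w) p = 0 := by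
  rw [← coordEquiv_apply b]
  exact mem_closure_zariski_iff.1 hw _ fun z hz => by rw [coordEquiv_apply]; exact hp z hz

lemma mem_closure_of_eval {Z : Set V} {w : V}
    (h : ∀ p : MvPolynomial ι K, (∀ z ∈ Z, eval (b.repr z) p = 0) → eval (b.repr w) p = 0) :
    w ∈ closure[zariski K V] Z := by
  refine mem_closure_zariski_iff.2 fun f hf => ?_
  obtain ⟨p, rfl⟩ := (coordEquiv b).surjective f
  rw [coordEquiv_apply]
  exact h p fun z hz => by rw [← coordEquiv_apply b]; exact hf z hz

lemma basisSupport_subset_of_mem_closure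
    (hχ : ∀ i t, ρ t (b i) = (character K (χ i) t : K) • b i) {v w : V}
    (hw : w ∈ closure[zariski K V] (orbit ρ v)) : basisSupport b w ⊆ basisSupport b v := by
  intro i hi hv
  apply hi
  have := eval_eq_zero_of_mem_closure (b := b) hw (X i) (by
    rintro _ ⟨t, rfl⟩
    rw [eval_X, repr_apply hχ, hv, mul_zero])
  rwa [eval_X] at this

/-- Invariant monomials are constant on orbit closures. -/
lemma prod_eq_of_mem_closure
    (hχ : ∀ i t, ρ t (b i) = (character K (χ i) t : K) • b i) {v w : V}
    (hw : w ∈ closure[zariski K V] (orbit ρ v)) {a : ι →₀ ℕ} (ha : a ∈ exponents χ) :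
    ∏ i ∈ a.support, b.repr w i ^ a i = ∏ i ∈ a.support, b.repr v i ^ a i := by
  have := eval_eq_zero_of_mem_closure (b := b) hw
    (monomial a 1 - C (∏ i ∈ a.support, b.repr v i ^ a i)) (by
      rintro _ ⟨t, rfl⟩
      rw [map_sub, eval_monomial, eval_C, Finsupp.prod, prod_repr_apply hχ,
        mem_exponents.1 ha]
      simp)
  rw [map_sub, eval_monomial, eval_C, Finsupp.prod, one_mul, sub_eq_zero] at this
  exact this

variable [IsAlgClosed K]

/-- If every coordinate in the support of `v` occurs in an invariant monomial that does not vanish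
at `v`, then the orbit of `v` is closed: a point of the closure has the same support as `v` and its
coordinates satisfy the same relations, so that it is obtained from `v` by an element of the
torus. -/
lemma isClosed_orbit (hχ : ∀ i t, ρ t (b i) = (character K (χ i) t : K) • b i) {v : V}
    (hI : ∀ j ∈ basisSupport b v, ∃ a ∈ exponents χ, 0 < a j ∧
      ∀ i, a i ≠ 0 → i ∈ basisSupport b v) :
    IsClosed[zariski K V] (orbit ρ v) := by
  refine (@closure_subset_iff_isClosed V (zariski K V) (orbit ρ v)).1 fun w hw => ?_
  have hsub := basisSupport_subset_of_mem_closure hχ hw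
  have hsup : basisSupport b v ⊆ basisSupport b w := by
    intro j hj
    obtain ⟨a, ha, haj, hav⟩ := hI j hj
    refine (prod_ne_zero_iff w a).1 ?_ j haj.ne'
    rw [prod_eq_of_mem_closure hχ hw ha]
    exact (prod_ne_zero_iff v a).2 hav
  classical
  let c : ι → Kˣ := fun i =>
    if h : i ∈ basisSupport b v then Units.mk0 _ (hsup h) / Units.mk0 _ h else 1
  have hc : ∀ i ∈ basisSupport b v, b.repr w i = c i * b.repr v i := by
    intro i hi
    simp only [c, dif_pos hi, Units.val_div_eq_div_val]
    exact (div_mul_cancel₀ (b.repr w i) (show b.repr v i ≠ 0 from hi)).symm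
  have hprod : ∀ a ∈ exponents χ, (∀ i, a i ≠ 0 → i ∈ basisSupport b v) →
      (a.prod fun i n => c i ^ n) = 1 := by
    intro a ha haI
    have h1 := prod_eq_of_mem_closure hχ hw ha
    have h2 : ∏ i ∈ a.support, b.repr w i ^ a i =
        (a.prod fun i n => c i ^ n : Kˣ) * ∏ i ∈ a.support, b.repr v i ^ a i := by
      rw [Finsupp.prod, Units.coe_prod, ← Finset.prod_mul_distrib]
      refine Finset.prod_congr rfl fun i hi => ?_
      rw [hc i (haI i (Finsupp.mem_support_iff.1 hi)), mul_pow, Units.val_pow_eq_pow_val]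
    rw [h2] at h1
    exact Units.ext ((mul_eq_right₀ ((prod_ne_zero_iff v a).2 haI)).1 h1)
  obtain ⟨t, ht⟩ := exists_character_eq (χ := χ) (basisSupport b v) c (by
    intro a a' ha ha' hw
    obtain ⟨d, hd, hdS⟩ := exists_add_mem hI a ha
    have hdS' : a' + d ∈ exponents χ := by
      rw [mem_exponents, map_add] at hdS ⊢
      rwa [← hw]
    have hsupp : ∀ {a : ι →₀ ℕ}, (∀ i, a i ≠ 0 → i ∈ basisSupport b v) →
        ∀ i, (a + d) i ≠ 0 → i ∈ basisSupport b v := by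
      intro a ha i hi
      by_contra h
      have h1 := not_imp_comm.1 (ha i) h
      have h2 := not_imp_comm.1 (hd i) h
      exact hi (by rw [Finsupp.add_apply, h1, h2])
    have h1 := hprod _ hdS (hsupp ha)
    have h2 := hprod _ hdS' (hsupp ha')
    rw [Finsupp.prod_add_index' (by simp) (by simp [pow_add])] at h1 h2
    exact mul_right_cancel (h1.trans h2.symm))
  refine ⟨t, b.ext_elem fun i => ?_⟩
  rw [repr_apply hχ]
  by_cases hi : i ∈ basisSupport b v
  · rw [ht i hi, hc i hi]
  · have hv : b.repr v i = 0 := not_not.1 hi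
    have hw : b.repr w i = 0 := not_not.1 fun h => hi (hsub h)
    rw [hv, hw, mul_zero]

/-- If the orbit of `v` is closed, then for every coordinate `j` in the support of `v` there is an
invariant monomial that involves `j` and does not vanish at `v`. By the Nullstellensatz, `x j` and
the functions vanishing on the orbit generate the unit ideal, so a multiple of `x j` is equal
to `1` on the orbit. The weight-zero part of this multiple does not vanish at `v`. -/
lemma exists_of_isClosed_orbit (hχ : ∀ i t, ρ t (b i) = (character K (χ i) t : K) • b i) {v : V}
    (hv : IsClosed[zariski K V] (orbit ρ v)) {j : ι} (hj : j ∈ basisSupport b v) :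
    ∃ a ∈ exponents χ, 0 < a j ∧ ∀ i, a i ≠ 0 → i ∈ basisSupport b v := by
  classical
  have := Fintype.ofFinite ι
  let I : Ideal (MvPolynomial ι K) :=
    vanishingIdeal K (Set.range fun t => (⇑(b.repr (ρ t v)) : ι → K))
  have htop : I ⊔ Ideal.span {X j} = ⊤ := by
    rw [← Ideal.radical_eq_top, ← vanishingIdeal_zeroLocus_eq_radical (K := K),
      Set.eq_empty_of_forall_notMem (s := MvPolynomial.zeroLocus K (I ⊔ Ideal.span {X j})),
      vanishingIdeal_empty]
    intro x hx
    have hmem : b.equivFun.symm x ∈ orbit ρ v := by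
      rw [← (@closure_eq_iff_isClosed V (zariski K V) (orbit ρ v)).2 hv]
      refine mem_closure_of_eval (b := b) fun p hp => ?_
      rw [repr_equivFun_symm]
      refine hx p (Ideal.mem_sup_left ?_)
      rintro _ ⟨t, rfl⟩
      exact hp _ ⟨t, rfl⟩
    obtain ⟨t, ht⟩ := hmem
    have h0 : x j = 0 := by
      simpa using hx (X j) (Ideal.mem_sup_right (Ideal.mem_span_singleton_self _))
    have h1 := congrArg (fun u => b.repr u j) ht
    simp only [repr_apply hχ, repr_equivFun_symm, h0] at h1
    exact (mul_ne_zero (Units.ne_zero _) hj) h1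
  obtain ⟨p, hp, q, hq, hpq⟩ := Submodule.mem_sup.1 ((Ideal.eq_top_iff_one _).1 htop)
  by_contra! hcon
  -- Along the orbit, `q` is a combination of nontrivial characters.
  have hspan : (fun t : Fin r → Kˣ => (character K 0 t : K)) ∈
      Submodule.span K ((fun (m : Fin r → ℤ) (t : Fin r → Kˣ) => (character K m t : K)) ''
        {m | m ≠ 0}) := by
    have h1 : (fun t : Fin r → Kˣ => (character K 0 t : K)) =
        ∑ a ∈ q.support, (coeff a q * ∏ i ∈ a.support, b.repr v i ^ a i) •
          fun t => (character K (Finsupp.weight χ a) t : K) := by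
      ext t
      have h2 := congrArg (eval (b.repr (ρ t v))) hpq
      have h3 : eval (b.repr (ρ t v)) p = 0 := hp _ ⟨t, rfl⟩
      rw [map_add, h3, zero_add, eval_eq] at h2
      simp only [prod_repr_apply hχ, map_one] at h2
      simp only [character_zero, Units.val_one, Finset.sum_apply, Pi.smul_apply, smul_eq_mul]
      rw [← h2]
      exact Finset.sum_congr rfl fun a _ => by ring
    rw [h1]
    refine Submodule.sum_mem _ fun a ha => ?_
    by_cases h0 : ∏ i ∈ a.support, b.repr v i ^ a i = 0
    · rw [h0, mul_zero, zero_smul]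
      exact Submodule.zero_mem _
    refine Submodule.smul_mem _ _ (Submodule.subset_span ⟨_, fun hw => ?_, rfl⟩)
    have haj : a j ≠ 0 := by
      obtain ⟨q', rfl⟩ := Ideal.mem_span_singleton.1 hq
      intro h
      rw [mem_support_iff, coeff_X_mul'] at ha
      simp [h] at ha
    obtain ⟨i, hi, hiv⟩ := hcon a hw (Nat.pos_of_ne_zero haj)
    exact hiv ((prod_ne_zero_iff v a).1 h0 i hi)
  exact linearIndependent_character.notMem_span_image (by simp) hspan

/-- If `v` is stable, then for every coordinate `j` outside the support of `v` there is an
invariant monomial that involves `j` and otherwise only coordinates in the support of `v`.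
Otherwise all `v + c • b j` with `c ≠ 0` are in the orbit of `v + b j`, which therefore has `v` in
its closure. -/
lemma exists_of_isStableVector_of_notMem
    (hχ : ∀ i t, ρ t (b i) = (character K (χ i) t : K) • b i) {v : V}
    (hv : IsStableVector ρ v) {j : ι} (hj : j ∉ basisSupport b v) :
    ∃ a ∈ exponents χ, 0 < a j ∧ ∀ i, a i ≠ 0 → i ∈ basisSupport b v ∨ i = j := by
  classical
  by_contra! hcon
  have hI := fun j hj => exists_of_isClosed_orbit (j := j) hχ hv.1 hj
  have hvj : b.repr v j = 0 := not_not.1 hj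
  -- The exponent of `x j` is determined by the weight of a monomial in the given coordinates.
  have hle : ∀ a a' : ι →₀ ℕ, (∀ i, a i ≠ 0 → i ∈ basisSupport b v ∨ i = j) →
      (∀ i, a' i ≠ 0 → i ∈ basisSupport b v ∨ i = j) →
      Finsupp.weight χ a = Finsupp.weight χ a' → a' j ≤ a j := by
    intro a a' ha ha' hw
    by_contra! hlt
    obtain ⟨d, hd, hdS⟩ := exists_add_mem hI (a.erase j) fun i hi => by
      have hij : i ≠ j := by rintro rfl; simp at hi
      rw [Finsupp.erase_ne hij] at hi
      exact (ha i hi).resolve_right hij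
    have hle : Finsupp.single j (a j) ≤ a' := by
      rw [Finsupp.single_le_iff]
      exact hlt.le
    have hmem : a' - Finsupp.single j (a j) + d ∈ exponents χ := by
      have h1 : Finsupp.single j (a j) + a.erase j = a := Finsupp.single_add_erase j a
      have h2 : a' - Finsupp.single j (a j) + Finsupp.single j (a j) = a' :=
        tsub_add_cancel_of_le hle
      rw [← h1, ← h2, map_add, map_add, add_comm, add_left_inj] at hw
      rw [mem_exponents, map_add] at hdS ⊢
      rwa [← hw]
    obtain ⟨i, hi, hi1, hi2⟩ := hcon _ hmem (by
      simp only [Finsupp.add_apply, Finsupp.tsub_apply, Finsupp.single_eq_same]; omega)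
    simp only [Finsupp.add_apply, Finsupp.tsub_apply] at hi
    rcases Nat.eq_zero_or_pos (d i) with h | h
    · rcases ha' i (by omega) with h | h
      · exact hi1 h
      · exact hi2 h
    · exact hi1 (hd i h.ne')
  have hmem : ∀ c : Kˣ, v + (c : K) • b j ∈ orbit ρ (v + b j) := by
    intro c
    obtain ⟨t, ht⟩ := exists_character_eq (χ := χ) {i | i ∈ basisSupport b v ∨ i = j}
      (Pi.mulSingle j c) (by
        intro a a' ha ha' hw
        have haj := le_antisymm (hle a' a ha' ha hw.symm) (hle a a' ha ha' hw)
        have : ∀ a : ι →₀ ℕ, (a.prod fun i n => (Pi.mulSingle j c : ι → Kˣ) i ^ n) = c ^ a j := by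
          intro a
          rw [Finsupp.prod_eq_single j]
          · simp
          · intro i _ hij
            simp [Pi.mulSingle_eq_of_ne hij]
          · simp
        rw [this, this, haj])
    refine ⟨t, b.ext_elem fun i => ?_⟩
    rw [repr_apply hχ]
    by_cases hij : i = j
    · subst hij
      rw [ht i (Or.inr rfl)]
      simp [hvj]
    · by_cases hi : i ∈ basisSupport b v
      · rw [ht i (Or.inl hi)]
        simp [Ne.symm hij]
      · have : b.repr v i = 0 := not_not.1 hi
        simp [this, Ne.symm hij]
  have hcl : v ∈ closure[zariski K V] (orbit ρ (v + b j)) := by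
    refine mem_closure_of_eval (b := b) fun p hp => ?_
    let g : Polynomial K := aeval (fun i => Polynomial.C (b.repr v i) +
      if i = j then Polynomial.X else 0) p
    have hg : ∀ c : K, g.eval c = eval (b.repr (v + c • b j)) p := by
      intro c
      have : (Polynomial.aeval c).comp (aeval fun i => Polynomial.C (b.repr v i) +
          if i = j then Polynomial.X else 0) = aeval (R := K) (b.repr (v + c • b j)) := by
        refine MvPolynomial.algHom_ext fun i => ?_
        by_cases hij : i = j
        · subst hij; simp
        · simp [hij]
      exact DFunLike.congr_fun this p
    have hg0 : g = 0 := by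
      refine Polynomial.eq_zero_of_infinite_isRoot g ?_
      refine (Set.finite_singleton (0 : K)).infinite_compl.mono fun c hc => ?_
      change g.eval c = 0
      rw [hg]
      exact hp _ (hmem (Units.mk0 c hc))
    have h0 := hg 0
    rw [hg0, zero_smul, add_zero, Polynomial.eval_zero] at h0
    exact h0.symm
  have heq := hv.2 _ hcl
  have hw : v + b j ∈ orbit ρ v := heq ▸ mem_orbit_self _
  obtain ⟨t, ht⟩ := hw
  have h1 := congrArg (fun u => b.repr u j) ht
  simp only [repr_apply hχ, hvj] at h1
  simp [hvj] at h1

/-- Stability of a vector depends only on its support in a basis of weight vectors. -/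
lemma isStableVector_iff (hχ : ∀ i t, ρ t (b i) = (character K (χ i) t : K) • b i) {v : V} :
    IsStableVector ρ v ↔ IsStableSupport (exponents χ) (basisSupport b v) := by
  constructor
  · intro hv j
    by_cases hj : j ∈ basisSupport b v
    · obtain ⟨a, ha, haj, h⟩ := exists_of_isClosed_orbit hχ hv.1 hj
      exact ⟨a, ha, haj, fun i hi => Or.inl (h i hi)⟩
    · exact exists_of_isStableVector_of_notMem hχ hv hj
  · intro hv
    have hclosed : ∀ w, IsStableSupport (exponents χ) (basisSupport b w) →
        IsClosed[zariski K V] (orbit ρ w) := by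
      refine fun w hw => isClosed_orbit hχ fun j hj => ?_
      obtain ⟨a, ha, haj, h⟩ := hw j
      exact ⟨a, ha, haj, fun i hi => (h i hi).elim id fun h => h ▸ hj⟩
    refine ⟨hclosed v hv, fun w hw => orbit_eq_of_mem ?_⟩
    rwa [(@closure_eq_iff_isClosed V (zariski K V) (orbit ρ w)).2
      (hclosed w (hv.mono (basisSupport_subset_of_mem_closure hχ hw)))] at hw

end Closure

end Stability

/-! ### Components of the strictly semistable locus -/

section Height

/-- A prime element that divides every nonzero element only finitely often generates an ideal of
height one. -/
lemma height_span_singleton_of_prime {R : Type*} [CommRing R] [IsDomain R] {p : R} (hp : Prime p)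
    (hfin : ∀ f : R, f ≠ 0 → FiniteMultiplicity p f) : (Ideal.span {p}).height = 1 := by
  have hprime : (Ideal.span {p}).IsPrime := (Ideal.span_singleton_prime hp.ne_zero).2 hp
  apply le_antisymm
  · refine Ideal.height_le_iff.2 fun q hq hlt => ?_
    have hpq : p ∉ q := fun h => hlt.not_ge ((Ideal.span_singleton_le_iff_mem _).2 h)
    have hbot : q = ⊥ := by
      rw [eq_bot_iff]
      intro f hf
      by_contra hf0
      obtain ⟨g, hfg, hg⟩ := (hfin f hf0).exists_eq_pow_mul_and_not_dvd
      rw [hfg] at hf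
      rcases hq.mem_or_mem hf with h | h
      · exact hpq (hq.mem_of_pow_mem _ h)
      · exact hg (Ideal.mem_span_singleton.1 (hlt.le h))
    rw [hbot, Ideal.height_bot]
    exact zero_lt_one
  · rw [Order.one_le_iff_ne_zero, Ne, Ideal.height_eq_zero_iff_eq_bot, Ideal.span_singleton_eq_bot]
    exact hp.ne_zero

end Height

section Components

open MvPolynomial

variable {K : Type*} [Field K] {V : Type*} [AddCommGroup V] [Module K V]
  {ι : Type*} {b : Module.Basis ι K V}

/-- The coordinate subspace of vectors supported in `I`. -/
def coordSubspace (b : Module.Basis ι K V) (I : Set ι) : Set V := {v | basisSupport b v ⊆ I}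

lemma coordSubspace_mono {I J : Set ι} (h : I ⊆ J) : coordSubspace b I ⊆ coordSubspace b J :=
  fun _ hv => hv.trans h

variable (K) in
/-- Setting all coordinates outside `I` equal to zero. -/
noncomputable def killOutside (I : Set ι) : MvPolynomial ι K →ₐ[K] MvPolynomial ι K :=
  open Classical in aeval fun i => if i ∈ I then X i else 0

lemma killOutside_monomial_of_subset {I : Set ι} {a : ι →₀ ℕ} (ha : ∀ i, a i ≠ 0 → i ∈ I)
    (c : K) : killOutside K I (monomial a c) = monomial a c := by
  rw [killOutside, aeval_monomial, monomial_eq, algebraMap_eq]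
  congr 1
  refine Finset.prod_congr rfl fun i hi => ?_
  dsimp only
  rw [if_pos (ha i (Finsupp.mem_support_iff.1 hi))]

lemma killOutside_monomial_of_not_subset {I : Set ι} {a : ι →₀ ℕ} {i : ι} (hai : a i ≠ 0)
    (hi : i ∉ I) (c : K) : killOutside K I (monomial a c) = 0 := by
  rw [killOutside, aeval_monomial, Finsupp.prod,
    Finset.prod_eq_zero (Finsupp.mem_support_iff.2 hai), mul_zero]
  rw [if_neg hi, zero_pow hai]

lemma coeff_killOutside {I : Set ι} {a : ι →₀ ℕ} (ha : ∀ i, a i ≠ 0 → i ∈ I)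
    (p : MvPolynomial ι K) : coeff a (killOutside K I p) = coeff a p := by
  classical
  induction p using MvPolynomial.induction_on' with
  | add p q hp hq => rw [map_add, coeff_add, coeff_add, hp, hq]
  | monomial d c =>
    by_cases hd : ∀ i, d i ≠ 0 → i ∈ I
    · rw [killOutside_monomial_of_subset hd]
    · push Not at hd
      obtain ⟨i, hdi, hi⟩ := hd
      rw [killOutside_monomial_of_not_subset hdi hi, coeff_zero, coeff_monomial, if_neg]
      rintro rfl
      exact hi (ha i hdi)

lemma killOutside_eq_zero_iff {I : Set ι} {p : MvPolynomial ι K} :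
    killOutside K I p = 0 ↔ p ∈ Ideal.span (X '' Iᶜ : Set (MvPolynomial ι K)) := by
  rw [mem_ideal_span_X_image]
  constructor
  · intro h a ha
    by_contra! hcon
    refine mem_support_iff.1 ha ?_
    rw [← coeff_killOutside (I := I) (fun i hi => by_contra fun h => hi (hcon i h)), h, coeff_zero]
  · intro h
    rw [p.as_sum, map_sum]
    refine Finset.sum_eq_zero fun a ha => ?_
    obtain ⟨i, hi, hai⟩ := h a ha
    exact killOutside_monomial_of_not_subset hai hi _

variable [CharZero K] [Finite ι]

lemma isDomain_coordRing (b : Module.Basis ι K V) : IsDomain (coordRing K V) :=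
  (coordEquiv b).symm.toMulEquiv.isDomain _

lemma uniqueFactorizationMonoid_coordRing (b : Module.Basis ι K V) :
    UniqueFactorizationMonoid (coordRing K V) :=
  (coordEquiv b).toMulEquiv.uniqueFactorizationMonoid inferInstance

/-- A polynomial function vanishes on the coordinate subspace of `I` if and only if setting the
coordinates outside `I` equal to zero gives the zero polynomial. -/
lemma coordEquiv_mem_idealOf {I : Set ι} {p : MvPolynomial ι K} :
    coordEquiv b p ∈ idealOf K (coordSubspace b I) ↔ killOutside K I p = 0 := by
  classical
  have := Fintype.ofFinite ι
  have hev : ∀ x : ι → K, eval x (killOutside K I p) = eval (I.indicator x) p := by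
    intro x
    have : (aeval (R := K) x).comp (killOutside K I) = aeval (R := K) (I.indicator x) := by
      refine MvPolynomial.algHom_ext fun i => ?_
      by_cases hi : i ∈ I <;> simp [killOutside, hi]
    exact DFunLike.congr_fun this p
  constructor
  · intro h
    refine MvPolynomial.funext fun x => ?_
    have h1 := h (b.equivFun.symm (I.indicator x)) (by
      intro i hi
      by_contra hiI
      refine hi ?_
      rw [repr_equivFun_symm, Set.indicator_of_notMem hiI])
    rw [hev, map_zero, ← repr_equivFun_symm (b := b) (I.indicator x), ← coordEquiv_apply]
    exact h1
  · intro h v hv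
    have h1 : I.indicator (b.repr v) = b.repr v := by
      ext i
      by_cases hi : i ∈ I
      · rw [Set.indicator_of_mem hi]
      · rw [Set.indicator_of_notMem hi]
        exact (not_not.1 fun h => hi (hv h)).symm
    rw [coordEquiv_apply, ← h1, ← hev, h, map_zero]

lemma isPrime_idealOf_coordSubspace (I : Set ι) :
    (idealOf K (coordSubspace b I)).IsPrime := by
  have : idealOf K (coordSubspace b I) =
      (RingHom.ker (killOutside K I)).comap (coordEquiv b).symm := by
    ext f
    obtain ⟨p, rfl⟩ := (coordEquiv b).surjective f
    rw [coordEquiv_mem_idealOf, Ideal.mem_comap, RingHom.mem_ker, AlgEquiv.symm_apply_apply]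
  rw [this]
  have := RingHom.ker_isPrime (killOutside K I)
  exact Ideal.IsPrime.comap _

lemma isClosed_coordSubspace (I : Set ι) : IsClosed[zariski K V] (coordSubspace b I) := by
  refine isClosed_zariski_iff.2 ⟨{f | ∃ i ∉ I, f = coordEquiv b (X i)}, ?_⟩
  ext v
  constructor
  · intro h i hi
    by_contra hiI
    have := h _ ⟨i, hiI, rfl⟩
    rw [coordEquiv_apply, eval_X] at this
    exact hi this
  · rintro h _ ⟨i, hiI, rfl⟩
    rw [coordEquiv_apply, eval_X]
    exact not_not.1 fun hi => hiI (h hi)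

lemma isIrreducible_coordSubspace (I : Set ι) :
    @IsIrreducible V (zariski K V) (coordSubspace b I) := by
  let := zariski K V
  refine ⟨⟨0, fun i hi => absurd (by simp) hi⟩, ?_⟩
  rw [isPreirreducible_iff_isClosed_union_isClosed]
  intro Y Z hY hZ hsub
  obtain ⟨S, rfl⟩ := isClosed_zariski_iff.1 hY
  obtain ⟨T, rfl⟩ := isClosed_zariski_iff.1 hZ
  by_contra! hcon
  obtain ⟨h1, h2⟩ := hcon
  obtain ⟨v, hv, hvS⟩ := Set.not_subset.1 h1
  obtain ⟨w, hw, hwT⟩ := Set.not_subset.1 h2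
  simp only [zeroLocus, Set.mem_ofPred_eq, not_forall] at hvS hwT
  obtain ⟨f, hf, hfv⟩ := hvS
  obtain ⟨g, hg, hgw⟩ := hwT
  have hfg : f * g ∈ idealOf K (coordSubspace b I) := by
    intro u hu
    rcases hsub hu with h | h
    · simp [h f hf]
    · simp [h g hg]
  rcases (isPrime_idealOf_coordSubspace I).mem_or_mem hfg with h | h
  · exact hfv (h v hv)
  · exact hgw (h w hw)

/-- A coordinate subspace whose ideal has height one is a coordinate hyperplane. -/
lemma exists_eq_compl_of_height_eq_one {I : Set ι}
    (h : (idealOf K (coordSubspace b I)).height = 1) : ∃ i, I = {i}ᶜ := by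
  have := isDomain_coordRing b
  have hprime := isPrime_idealOf_coordSubspace (b := b)
  have hX : ∀ {J : Set ι} {i : ι},
      coordEquiv b (X i) ∈ idealOf K (coordSubspace b J) ↔ i ∉ J := by
    intro J i
    classical
    rw [coordEquiv_mem_idealOf, killOutside, aeval_X]
    by_cases hi : i ∈ J <;> simp [hi]
  have hne : I ≠ Set.univ := by
    rintro rfl
    refine Ideal.ne_bot_of_height_eq_one h (eq_bot_iff.2 fun f hf => ?_)
    exact Subtype.ext (funext fun v => hf v (Set.subset_univ _))
  obtain ⟨i, hi⟩ := (Set.ne_univ_iff_exists_notMem I).1 hne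
  refine ⟨i, ?_⟩
  have hle : I ⊆ {i}ᶜ := fun j hj hji => hi (hji ▸ hj)
  by_contra hne
  obtain ⟨j, hji, hj⟩ := Set.not_subset.1 fun h => hne (hle.antisymm h)
  have hlt : idealOf K (coordSubspace b {i}ᶜ) < idealOf K (coordSubspace b I) := by
    refine lt_of_le_of_ne (fun f hf v hv => hf v (coordSubspace_mono hle hv)) fun heq => ?_
    exact hX.1 (heq ▸ hX.2 hj) hji
  have h1 := Ideal.height_add_one_le_of_lt_of_isPrime hlt
  have h0 : (idealOf K (coordSubspace b {i}ᶜ)).height = 0 := by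
    rw [h] at h1
    by_contra hc
    have := add_le_add_left (Order.one_le_iff_ne_zero.2 hc) 1
    exact absurd (this.trans h1) (by decide)
  rw [Ideal.height_eq_zero_iff_eq_bot] at h0
  have hmem : coordEquiv b (X i) ∈ idealOf K (coordSubspace b {i}ᶜ) := hX.2 (by simp)
  rw [h0, Ideal.mem_bot, EmbeddingLike.map_eq_zero_iff] at hmem
  exact X_ne_zero i hmem

lemma height_idealOf_coordSubspace_compl (i : ι) :
    (idealOf K (coordSubspace b {i}ᶜ)).height = 1 := by
  have := isDomain_coordRing b
  have := uniqueFactorizationMonoid_coordRing b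
  have hprime : Prime (coordEquiv b (X i)) :=
    (MulEquiv.prime_iff (coordEquiv b).toMulEquiv).2 X_prime
  have : idealOf K (coordSubspace b {i}ᶜ) = Ideal.span {coordEquiv b (X i)} := by
    ext f
    obtain ⟨p, rfl⟩ := (coordEquiv b).surjective f
    rw [coordEquiv_mem_idealOf, killOutside_eq_zero_iff, compl_compl, Set.image_singleton,
      Ideal.mem_span_singleton, Ideal.mem_span_singleton]
    exact (map_dvd_iff (coordEquiv b)).symm
  rw [this]
  exact height_span_singleton_of_prime hprime fun f hf =>
    FiniteMultiplicity.of_not_isUnit hprime.not_isUnit hf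

end Components

lemma mem_imageIdeal {K : Type*} [Field K] {V : Type*} [AddCommGroup V] [Module K V] {r : ℕ}
    {ρ : Representation K (Fin r → Kˣ) V} {Z : Set V} {f : invariantRing ρ} :
    f ∈ imageIdeal ρ Z ↔ f.1 ∈ idealOf K Z := by
  rw [imageIdeal, PrimeSpectrum.mem_vanishingIdeal, Set.forall_mem_image]
  rfl

/-! ### Cofree and cnpure representations -/

section Main

open MvPolynomial

variable {K : Type*} [Field K] [IsAlgClosed K] [CharZero K] {V : Type*} [AddCommGroup V]
  [Module K V] {r : ℕ} {ρ : Representation K (Fin r → Kˣ) V} {ι : Type*} [Finite ι]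
  {b : Module.Basis ι K V} {χ : ι → Fin r → ℤ}

/-- The irreducible components of the strictly semistable locus are the coordinate subspaces of the
maximal unstable supports. -/
lemma mem_components_iff (hχ : ∀ i t, ρ t (b i) = (character K (χ i) t : K) • b i) {Z : Set V} :
    Z ∈ components K (strictlySemistable ρ) ↔
      ∃ I, Maximal (fun I => ¬ IsStableSupport (exponents χ) I) I ∧ Z = coordSubspace b I := by
  classical
  have := Fintype.ofFinite ι
  have hsub : ∀ {I : Set ι}, ¬ IsStableSupport (exponents χ) I →
      coordSubspace b I ⊆ strictlySemistable ρ := by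
    intro I hI v hv hst
    exact hI (((isStableVector_iff hχ).1 hst).mono hv)
  have hexists : ∀ {Y : Set V}, @IsIrreducible V (zariski K V) Y → Y ⊆ strictlySemistable ρ →
      ∃ I, ¬ IsStableSupport (exponents χ) I ∧ Y ⊆ coordSubspace b I := by
    intro Y hY hYs
    obtain ⟨Z, hZ, hYZ⟩ := (@isIrreducible_iff_sUnion_isClosed V (zariski K V) Y).1 hY
      ((Set.toFinite {I | ¬ IsStableSupport (exponents χ) I}).toFinset.image (coordSubspace b))
      (by
        intro Z hZ
        obtain ⟨I, -, rfl⟩ := Finset.mem_image.1 hZ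
        exact isClosed_coordSubspace I)
      (fun v hv => ⟨coordSubspace b (basisSupport b v), by
        simp only [Finset.coe_image, Set.Finite.coe_toFinset]
        exact ⟨_, fun h => hYs hv ((isStableVector_iff hχ).2 h), rfl⟩,
          Set.Subset.refl (basisSupport b v)⟩)
    obtain ⟨I, hI, rfl⟩ := Finset.mem_image.1 hZ
    exact ⟨I, by simpa using hI, hYZ⟩
  constructor
  · rintro ⟨⟨hirr, hZ⟩, hmax⟩
    obtain ⟨I, hI, hZI⟩ := hexists hirr hZ
    obtain ⟨J, hIJ, hJ⟩ :=
      (Set.toFinite {I | ¬ IsStableSupport (exponents χ) I}).exists_le_maximal hI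
    have hZJ := hZI.trans (coordSubspace_mono hIJ)
    exact ⟨J, hJ, hZJ.antisymm (hmax ⟨isIrreducible_coordSubspace J, hsub hJ.1⟩ hZJ)⟩
  · rintro ⟨I, hI, rfl⟩
    refine ⟨⟨isIrreducible_coordSubspace I, hsub hI.1⟩, fun Y hY hIY => ?_⟩
    obtain ⟨J, hJ, hYJ⟩ := hexists hY.1 hY.2
    refine hYJ.trans (coordSubspace_mono (hI.2 hJ fun i hi => ?_))
    have hbi : b i ∈ coordSubspace b I := by
      intro j hj
      have : i = j := by
        by_contra h
        exact hj (by simp [Ne.symm h])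
      exact this ▸ hi
    exact hYJ (hIY hbi) (by simp [basisSupport])

lemma invariantEquiv_mem_imageIdeal
    (hχ : ∀ i t, ρ t (b i) = (character K (χ i) t : K) • b i) {i : ι}
    {p : supportedIn K (exponents χ)} :
    invariantEquiv hχ p ∈ imageIdeal ρ (coordSubspace b {i}ᶜ) ↔
      ∀ a ∈ (p : MvPolynomial ι K).support, a i ≠ 0 := by
  rw [mem_imageIdeal]
  change coordEquiv b p ∈ _ ↔ _
  rw [coordEquiv_mem_idealOf, killOutside_eq_zero_iff, compl_compl, mem_ideal_span_X_image]
  simp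

/-- If there is a least exponent `s` of invariant monomials that vanish on the hyperplane
`x i = 0`, then `x ^ s` generates the ideal of all invariants that vanish on this hyperplane. -/
lemma imageIdeal_eq_span (hχ : ∀ i t, ρ t (b i) = (character K (χ i) t : K) • b i) {i : ι}
    {s : ι →₀ ℕ} (hs : s ∈ exponents χ) (hsi : 0 < s i)
    (hmin : ∀ a ∈ exponents χ, 0 < a i → s ≤ a) :
    imageIdeal ρ (coordSubspace b {i}ᶜ) =
      Ideal.span {invariantEquiv hχ ⟨monomial s 1, monomial_mem_supportedIn hs 1⟩} := by
  classical
  apply le_antisymm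
  · intro f hf
    obtain ⟨p, rfl⟩ := (invariantEquiv hχ).surjective f
    rw [invariantEquiv_mem_imageIdeal] at hf
    have hdvd : (p : MvPolynomial ι K) ∈
        Ideal.span ((fun s => monomial s (1 : K)) '' {s}) := by
      rw [mem_ideal_span_monomial_image]
      exact fun a ha => ⟨s, rfl, hmin a (p.2 a ha) (Nat.pos_of_ne_zero (hf a ha))⟩
    rw [Set.image_singleton, Ideal.mem_span_singleton] at hdvd
    obtain ⟨q, hq⟩ := hdvd
    have hqS : q ∈ supportedIn K (exponents χ) := by
      rw [mem_supportedIn]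
      intro a ha
      refine exponents_cancel s a hs (mem_supportedIn.1 p.2 _ ?_)
      rwa [hq, coeff_monomial_mul, one_mul]
    have hp : p = ⟨monomial s 1, monomial_mem_supportedIn hs 1⟩ * ⟨q, hqS⟩ := Subtype.ext hq
    rw [hp, map_mul]
    exact Ideal.mul_mem_right _ _ (Ideal.mem_span_singleton_self _)
  · rw [Ideal.span_singleton_le_iff_mem, invariantEquiv_mem_imageIdeal]
    intro a ha
    rw [mem_support_iff, coeff_monomial] at ha
    obtain rfl : s = a := by by_contra h; simp [h] at ha
    exact hsi.ne'

lemma isCNPure_of_hasLeast (hχ : ∀ i t, ρ t (b i) = (character K (χ i) t : K) • b i)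
    (h : ∀ i, HasLeast (exponents χ) i) : IsCNPure ρ := by
  have hcomp : ∀ Z ∈ components K (strictlySemistable ρ), ∃ i, Z = coordSubspace b {i}ᶜ := by
    intro Z hZ
    obtain ⟨I, hI, rfl⟩ := (mem_components_iff hχ).1 hZ
    obtain ⟨i, hiU, hiI⟩ := Set.not_subset.1 fun hsub =>
      hI.1 ((isStableSupport_criticalSet h).mono hsub)
    have hle : I ⊆ {i}ᶜ := fun j hj hji => hiI (hji ▸ hj)
    exact ⟨i, by rw [hle.antisymm (hI.2 hiU hle)]⟩
  refine ⟨⟨fun Z hZ => ?_, fun Z hZ => ?_⟩, fun Z hZ => ?_⟩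
  · obtain ⟨i, rfl⟩ := hcomp Z hZ
    exact height_idealOf_coordSubspace_compl i
  · obtain ⟨i, rfl⟩ := hcomp Z hZ
    obtain ⟨s, hs, hsi, hmin⟩ := h i
    have := isDomain_coordRing b
    have := uniqueFactorizationMonoid_coordRing b
    have hP := isPrime_idealOf_coordSubspace (b := b) {i}ᶜ
    have hprime : (imageIdeal ρ (coordSubspace b {i}ᶜ)).IsPrime := by
      have : imageIdeal ρ (coordSubspace b {i}ᶜ) =
          (idealOf K (coordSubspace b {i}ᶜ)).comap (invariantRing ρ).val := by
        ext f
        exact mem_imageIdeal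
      rw [this]
      exact Ideal.IsPrime.comap _
    have hmem : invariantEquiv hχ ⟨monomial s 1, monomial_mem_supportedIn hs 1⟩ ∈
        imageIdeal ρ (coordSubspace b {i}ᶜ) := by
      rw [imageIdeal_eq_span hχ hs hsi hmin]
      exact Ideal.mem_span_singleton_self _
    rw [imageIdeal_eq_span hχ hs hsi hmin] at hprime ⊢
    set m := invariantEquiv hχ ⟨monomial s 1, monomial_mem_supportedIn hs 1⟩
    have hm0 : m ≠ 0 := by
      rw [Ne, EmbeddingLike.map_eq_zero_iff, Subtype.ext_iff]
      simp
    refine height_span_singleton_of_prime ((Ideal.span_singleton_prime hm0).1 hprime)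
      fun f hf => ?_
    -- Multiplicities are finite because they are in the larger ring `K[V]`, which is factorial.
    have hunit : ¬ IsUnit m.1 := fun hu =>
      hP.ne_top (Ideal.eq_top_of_isUnit_mem _ (mem_imageIdeal.1 hmem) hu)
    obtain ⟨n, hn⟩ := FiniteMultiplicity.of_not_isUnit hunit
      (b := f.1) fun h0 => hf (Subtype.ext h0)
    exact ⟨n, fun hd => hn (by simpa using map_dvd (invariantRing ρ).val hd)⟩
  · obtain ⟨i, rfl⟩ := hcomp Z hZ
    obtain ⟨s, hs, hsi, hmin⟩ := h i
    exact ⟨_, imageIdeal_eq_span hχ hs hsi hmin⟩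

/-- A generator of the ideal of invariants that vanish on the hyperplane `x i = 0` divides
monomials, hence is a monomial, and its exponent is the least one that involves `i`. -/
lemma hasLeast_of_isPrincipal (hχ : ∀ i t, ρ t (b i) = (character K (χ i) t : K) • b i) {i : ι}
    (hi : ∃ a ∈ exponents χ, 0 < a i)
    (h : (imageIdeal ρ (coordSubspace b {i}ᶜ)).IsPrincipal) : HasLeast (exponents χ) i := by
  classical
  obtain ⟨g, hg⟩ := h
  obtain ⟨q, rfl⟩ := (invariantEquiv hχ).surjective g
  have hdvd : ∀ a ∈ exponents χ, 0 < a i → (q : MvPolynomial ι K) ∣ monomial a 1 := by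
    intro a ha hai
    have hmem : invariantEquiv hχ ⟨monomial a 1, monomial_mem_supportedIn ha 1⟩ ∈
        imageIdeal ρ (coordSubspace b {i}ᶜ) := by
      rw [invariantEquiv_mem_imageIdeal]
      intro d hd
      rw [mem_support_iff, coeff_monomial] at hd
      obtain rfl : a = d := by by_contra h; simp [h] at hd
      exact hai.ne'
    rw [hg] at hmem
    have := (map_dvd_iff (invariantEquiv hχ)).1 (Ideal.mem_span_singleton.1 hmem)
    exact map_dvd (supportedIn K (exponents χ)).val this
  obtain ⟨a, ha, hai⟩ := hi
  obtain ⟨s, c, -, hc, hq⟩ := (dvd_monomial_iff_exists one_ne_zero).1 (hdvd a ha hai)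
  have hc0 : c ≠ 0 := ne_zero_of_dvd_ne_zero one_ne_zero hc
  have hss : s ∈ (q : MvPolynomial ι K).support := by
    rw [hq, mem_support_iff, coeff_monomial, if_pos rfl]
    exact hc0
  have hqmem : invariantEquiv hχ q ∈ imageIdeal ρ (coordSubspace b {i}ᶜ) := by
    rw [hg]
    exact Ideal.mem_span_singleton_self _
  rw [invariantEquiv_mem_imageIdeal] at hqmem
  refine ⟨s, q.2 s hss, Nat.pos_of_ne_zero (hqmem s hss), fun a ha hai => ?_⟩
  have := hdvd a ha hai
  rw [hq, monomial_dvd_monomial] at this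
  exact this.1.resolve_left one_ne_zero

lemma hasLeast_of_isCNPure (hχ : ∀ i t, ρ t (b i) = (character K (χ i) t : K) • b i)
    (huniv : IsStableSupport (exponents χ) Set.univ) (h : IsCNPure ρ) (i : ι) :
    HasLeast (exponents χ) i := by
  have hU : IsStableSupport (exponents χ) (criticalSet (exponents χ)) := by
    by_contra hcon
    obtain ⟨J, hUJ, hJ⟩ :=
      (Set.toFinite {I | ¬ IsStableSupport (exponents χ) I}).exists_le_maximal hcon
    obtain ⟨j, rfl⟩ := exists_eq_compl_of_height_eq_one
      (h.1.1 _ ((mem_components_iff hχ).2 ⟨J, hJ, rfl⟩))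
    exact hUJ (show j ∈ criticalSet (exponents χ) from hJ.1) rfl
  refine hasLeast_of_isStableSupport exponents_cancel exponents_saturated hU (fun j hj => ?_) i
  obtain ⟨a, ha, haj, -⟩ := huniv j
  refine hasLeast_of_isPrincipal hχ ⟨a, ha, haj⟩ (h.2 _ ((mem_components_iff hχ).2 ⟨_, ?_, rfl⟩))
  refine ⟨hj, fun J hJ hle k hk hkj => hJ ?_⟩
  convert huniv
  refine Set.eq_univ_of_forall fun l => ?_
  by_cases hl : l = j
  · rw [hl, ← show k = j from hkj]
    exact hk
  · exact hle hl

end Main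

end TorusRep

theorem mainTheorem3 {K : Type*} [Field K] [IsAlgClosed K] [CharZero K]
    {V : Type*} [AddCommGroup V] [Module K V] [FiniteDimensional K V]
    {r : ℕ} (ρ : Representation K (Fin r → Kˣ) V)
    (halg : TorusRep.IsAlgebraic ρ) (hst : TorusRep.IsStable ρ) :
    TorusRep.IsCofree ρ ↔ TorusRep.IsCNPure ρ := by
  obtain ⟨s, b, χ, hχ⟩ := TorusRep.exists_weightBasis halg
  have : Finite s := Module.Finite.finite_basis b
  obtain ⟨v, hv⟩ := hst
  have huniv := ((TorusRep.isStableVector_iff hχ).1 hv).mono (Set.subset_univ _)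
  rw [TorusRep.isCofree_iff_inf_mem hχ]
  constructor
  · intro h
    refine TorusRep.isCNPure_of_hasLeast hχ fun i => TorusRep.hasLeast_of_inf_mem h ?_
    obtain ⟨a, ha, hai, -⟩ := huniv i
    exact ⟨a, ha, hai⟩
  · intro h
    exact TorusRep.inf_mem_of_hasLeast TorusRep.exponents_cancel
      (TorusRep.hasLeast_of_isCNPure hχ huniv h)
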